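/- Let $H$ and $E$ be Banach spaces over the same scalar field ($\mathbb{R}$ or $\mathbb{C}$), and let $\mathcal{X}\subset\mathcal{L}(H,E)$ be a linear subspace which is a Banach space under a norm satisfying $\|T\|_{\mathcal{L}(H,E)}\le\|T\|_{\mathcal{X}}$ for all $T\in\mathcal{X}$. For a family $\mathcal{T}\subset\mathcal{L}(H,E)$ let $\mathcal{R}(\mathcal{T})\in[0,\infty]$ be its R-bound, that is, the infimum of all $C\ge 0$ such that $$\mathbb{E}\Big\|\sum_{j=1}^N\varepsilon_jT_jx_j\Big\|^2\le C^2\,\mathbb{E}\Big\|\sum_{j=1}^N\varepsilon_jx_j\Big\|^2$$ for all $N$, all $T_1,\dots,T_N\in\mathcal{T}$ and all $x_1,\dots,x_N\in H$, where $\varepsilon_1,\dots,\varepsilon_N$ are independent random variables, each taking the values $1$ and $-1$ with probability $1/2$ (and $\inf\emptyset=\infty$). For $1<p<\infty$ say that $\mathcal{X}$ has $\mathrm{RMF}_p$ if the Rademacher maximal operator of the filtration of dyadic intervals on $[0,1)$ is bounded from $L^p([0,1);\mathcal{X})$ to $L^p([0,1))$; that is, there is a constant $C$ such that for all $f\in L^p([0,1);\mathcal{X})$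 $$\|M_Rf\|_{L^p}\le C\|f\|_{L^p(\mathcal{X})},\qquad M_Rf(\xi)=\mathcal{R}\big(\mathbb{E}(f\mid\mathcal{D}_j)(\xi):j\ge 0\big),$$ where $\mathcal{D}_j$ is the $\sigma$-algebra on $[0,1)$ generated by the intervals $[k2^{-j},(k+1)2^{-j})$, $0\le k<2^j$, and $[0,1)$ carries Lebesgue measure. Say that $\mathcal{X}$ has weak RMF if there is a constant $C$ such that for every probability space and every martingale $X=(X_j)_{j=1}^\infty$ on it with values in $\mathcal{X}$ and $\|X\|_1:=\sup_j\mathbb{E}\|X_j\|_{\mathcal{X}}<\infty$, $$\mathbb{P}(X_R^*>\lambda)\le\frac{C}{\lambda}\|X\|_1\quad\text{for all }\lambda>0,\qquad\text{where } X_R^*=\mathcal{R}(X_j:j\ge 1).$$ Proposition. If $\mathcal{X}$ has $\mathrm{RMF}_p$ for some $p\in(1,\infty)$, then $\mathcal{X}$ has weak RMF. -/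

import Mathlib

open MeasureTheory
open scoped NNReal ENNReal BigOperators

/-- `C` is an R-bound (with exponent `2`) for the family `𝒯`: for all `T₁, …, T_N ∈ 𝒯`
(repetitions allowed) and `x₁, …, x_N ∈ H`,
`𝔼 ‖∑ ε_j T_j x_j‖² ≤ C² 𝔼 ‖∑ ε_j x_j‖²`. The expectation with respect to the Rademacher
variables `ε₁, …, ε_N` is the average over all `2 ^ N` choices of signs in `ℤˣ = {1, -1}`. -/
def IsRBoundFor {𝕜 H E : Type*} [RCLike 𝕜]
    [NormedAddCommGroup H] [NormedSpace 𝕜 H] [NormedAddCommGroup E] [NormedSpace 𝕜 E]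
    (𝒯 : Set (H →L[𝕜] E)) (C : ℝ≥0) : Prop :=
  ∀ (N : ℕ) (T : Fin N → H →L[𝕜] E) (x : Fin N → H), (∀ j, T j ∈ 𝒯) →
    (𝔼 ε : Fin N → ℤˣ, ‖∑ j, ε j • T j (x j)‖ ^ 2) ≤
      (C : ℝ) ^ 2 * 𝔼 ε : Fin N → ℤˣ, ‖∑ j, ε j • x j‖ ^ 2

/-- The R-bound `ℛ(𝒯) = ℛ₂(𝒯)`: the smallest admissible constant, `∞` if there is none. -/
noncomputable def rBound {𝕜 H E : Type*} [RCLike 𝕜]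
    [NormedAddCommGroup H] [NormedSpace 𝕜 H] [NormedAddCommGroup E] [NormedSpace 𝕜 E]
    (𝒯 : Set (H →L[𝕜] E)) : ℝ≥0∞ :=
  ⨅ (C : ℝ≥0) (_ : IsRBoundFor 𝒯 C), (C : ℝ≥0∞)

/-- The Rademacher maximal function `X_R^*(ω) = ℛ(X_j(ω) : j)` of a family `X` of functions with
values in `𝒳`, where `emb` is the inclusion of `𝒳` in `ℒ(H, E)`. -/
noncomputable def rademacherMax {𝕜 H E 𝒳 Ω J : Type*} [RCLike 𝕜]
    [NormedAddCommGroup H] [NormedSpace 𝕜 H] [NormedAddCommGroup E] [NormedSpace 𝕜 E]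
    [NormedAddCommGroup 𝒳] [NormedSpace 𝕜 𝒳]
    (emb : 𝒳 →ₗ[𝕜] (H →L[𝕜] E)) (X : J → Ω → 𝒳) (ω : Ω) : ℝ≥0∞ :=
  rBound (Set.range fun j => emb (X j ω))

/-- `𝒳` has `RMF_p` with respect to the filtration `ℱ` on the finite measure space `(Ω, μ)`: the
Rademacher maximal operator `M_R f = ℛ(𝔼(f | ℱ_j) : j)` is bounded from `L^p(𝒳)` to `L^p`. -/
def HasRMFWith {𝕜 H E 𝒳 Ω J : Type*} [RCLike 𝕜]
    [NormedAddCommGroup H] [NormedSpace 𝕜 H] [NormedAddCommGroup E] [NormedSpace 𝕜 E]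
    [NormedAddCommGroup 𝒳] [NormedSpace 𝕜 𝒳] [NormedSpace ℝ 𝒳] [CompleteSpace 𝒳]
    (emb : 𝒳 →ₗ[𝕜] (H →L[𝕜] E)) (p : ℝ≥0∞) [Preorder J] {m : MeasurableSpace Ω}
    (ℱ : Filtration J m) (μ : Measure Ω) [IsFiniteMeasure μ] : Prop :=
  ∃ C : ℝ≥0, ∀ f : Ω → 𝒳, MemLp f p μ →
    eLpNorm (rademacherMax emb fun j => μ[f | ℱ j]) p μ ≤ C * eLpNorm f p μ

/-- The dyadic interval `[k 2^{-j}, (k + 1) 2^{-j})`, as a subset of `[0, 1)`. -/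
def dyadicInterval (j k : ℕ) : Set (Set.Ico (0 : ℝ) 1) :=
  {x | (k : ℝ) / 2 ^ j ≤ x ∧ (x : ℝ) < (k + 1) / 2 ^ j}

theorem dyadicInterval_eq_union (j k : ℕ) :
    dyadicInterval j k = dyadicInterval (j + 1) (2 * k) ∪ dyadicInterval (j + 1) (2 * k + 1) := by
  ext x
  have h2 : (0 : ℝ) < 2 ^ j := by positivity
  have h3 : (0 : ℝ) < 2 ^ j * 2 := by positivity
  simp only [dyadicInterval, Set.mem_ofPred_eq, Set.mem_union, pow_succ, Nat.cast_add,
    Nat.cast_mul, Nat.cast_ofNat, Nat.cast_one, div_le_iff₀ h2, lt_div_iff₀ h2,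
    div_le_iff₀ h3, lt_div_iff₀ h3]
  constructor
  · rintro ⟨h, h'⟩
    rcases lt_or_ge ((x : ℝ) * (2 ^ j * 2)) (2 * k + 1) with hx | hx
    · exact Or.inl ⟨by linarith, hx⟩
    · exact Or.inr ⟨hx, by linarith⟩
  · rintro (⟨h, h'⟩ | ⟨h, h'⟩) <;> exact ⟨by linarith, by linarith⟩

/-- The filtration `(𝒟_j)_{j ≥ 0}` of dyadic intervals on `[0, 1)`: `𝒟_j` is generated by the
dyadic intervals of length `2^{-j}`. -/
def dyadicFiltration :
    Filtration ℕ (inferInstance : MeasurableSpace (Set.Ico (0 : ℝ) 1)) where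
  seq j := MeasurableSpace.generateFrom {I | ∃ k < 2 ^ j, I = dyadicInterval j k}
  mono' := by
    refine monotone_nat_of_le_succ fun j => MeasurableSpace.generateFrom_le ?_
    rintro _ ⟨k, hk, rfl⟩
    rw [dyadicInterval_eq_union]
    refine @MeasurableSet.union _ (_) _ _
      (MeasurableSpace.measurableSet_generateFrom ⟨2 * k, ?_, rfl⟩)
      (MeasurableSpace.measurableSet_generateFrom ⟨2 * k + 1, ?_, rfl⟩) <;>
    · rw [pow_succ]; omega
  le' j := by
    refine MeasurableSpace.generateFrom_le ?_
    rintro _ ⟨k, hk, rfl⟩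
    exact (measurableSet_le measurable_const measurable_subtype_coe).inter
      (measurableSet_lt measurable_subtype_coe measurable_const)

/-- Lebesgue measure on `[0, 1)`. -/
noncomputable def lebesgueIco : Measure (Set.Ico (0 : ℝ) 1) :=
  Measure.comap Subtype.val volume

instance isProbabilityMeasure_lebesgueIco : IsProbabilityMeasure lebesgueIco := by
  constructor
  rw [lebesgueIco, comap_subtype_coe_apply measurableSet_Ico, Set.image_univ, Subtype.range_coe]
  simp

/-- `𝒳` has `RMF_p`: the Rademacher maximal operator of the filtration of dyadic intervals on
`[0, 1)` (with Lebesgue measure) is bounded from `L^p(𝒳)` to `L^p`. -/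
def HasRMF {𝕜 H E 𝒳 : Type*} [RCLike 𝕜]
    [NormedAddCommGroup H] [NormedSpace 𝕜 H] [NormedAddCommGroup E] [NormedSpace 𝕜 E]
    [NormedAddCommGroup 𝒳] [NormedSpace 𝕜 𝒳] [NormedSpace ℝ 𝒳] [CompleteSpace 𝒳]
    (emb : 𝒳 →ₗ[𝕜] (H →L[𝕜] E)) (p : ℝ≥0∞) : Prop :=
  HasRMFWith emb p dyadicFiltration lebesgueIco

universe v

/-- `𝒳` has weak RMF: there is a constant `C` such that `ℙ(X_R^* > l) ≤ (C / l) ‖X‖₁` for every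
`l > 0` and every `L¹`-bounded martingale `X` in `𝒳` on any probability space, where
`‖X‖₁ = sup_j 𝔼 ‖X_j‖`. -/
def HasWeakRMF {𝕜 H E 𝒳 : Type*} [RCLike 𝕜]
    [NormedAddCommGroup H] [NormedSpace 𝕜 H] [NormedAddCommGroup E] [NormedSpace 𝕜 E]
    [NormedAddCommGroup 𝒳] [NormedSpace 𝕜 𝒳] [NormedSpace ℝ 𝒳] [CompleteSpace 𝒳]
    (emb : 𝒳 →ₗ[𝕜] (H →L[𝕜] E)) : Prop :=
  ∃ C : ℝ≥0, ∀ (Ω : Type v) (m : MeasurableSpace Ω) (P : Measure Ω) [IsProbabilityMeasure P]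
    (ℱ : Filtration ℕ m) (X : ℕ → Ω → 𝒳), Martingale X ℱ P →
    (⨆ j, eLpNorm (X j) 1 P) < ∞ →
    ∀ l : ℝ≥0, 0 < l →
      P {ω | (l : ℝ≥0∞) < rademacherMax emb X ω} ≤
        ((C / l : ℝ≥0) : ℝ≥0∞) * ⨆ j, eLpNorm (X j) 1 P

/-! The proof passes from a strong type estimate on dyadic martingales to a weak type estimate on
all martingales by means of a Bellman function.

A finite dyadic martingale is a binary tree. Realised on `[0, 1)`, it consists of the conditional
expectations of its final value, so `RMF_p` and Chebyshev's inequality give a level-`l` estimate in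
terms of `p`-th moments (`rpow_mul_eval_rIndicator_le`). Stopping the tree when the conditional mean
of the final norm exceeds `l` costs probability at most `𝔼‖·‖ / l`. It also keeps the conditional
mean norms at most `2 * l`, which turns the `p`-th moment into a first moment. This is the weak type
bound on trees, with a constant `K = K₀ / l` independent of the tree (`eval_rIndicator_le`).

Next, let `U S x` be the supremum, over trees starting at `x`, of the probability that `S` together
with the path has R-bound above `l`, minus `K` times the mean final norm. The weak type bound says
`U ∅ ≤ 0`. Gluing two trees under a common root makes `U S` midpoint concave, hence concave
(`concaveOn_bellman`). Concavity is no longer tied to halving: by Jensen, the estimate passes to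
averages over atoms split into finitely many pieces of arbitrary masses
(`measureReal_atomAverages_le`).

Finally, an arbitrary `L¹` martingale is an almost everywhere limit of such averages
(`exists_lists_tendsto_lastAverage`). The event that an R-bound exceeds `l` is stable under small
perturbations (`eventually_lt_rBound`), so the estimate survives the limit. -/

/-! ### R-bounds: attainment and monotonicity. -/

section RBound

variable {𝕜 H E : Type*} [RCLike 𝕜]
  [NormedAddCommGroup H] [NormedSpace 𝕜 H] [NormedAddCommGroup E] [NormedSpace 𝕜 E]

theorem IsRBoundFor.mono {𝒮 𝒯 : Set (H →L[𝕜] E)} {C D : ℝ≥0} (h : IsRBoundFor 𝒯 C)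
    (hS : 𝒮 ⊆ 𝒯) (hCD : C ≤ D) : IsRBoundFor 𝒮 D := by
  intro N T x hT
  refine (h N T x fun j => hS (hT j)).trans ?_
  have hCD' : (C : ℝ) ≤ D := hCD
  have : 0 ≤ 𝔼 ε : Fin N → ℤˣ, ‖∑ j, ε j • x j‖ ^ 2 :=
    Finset.expect_nonneg fun _ _ => by positivity
  gcongr

/-- The infimum defining the R-bound is attained. -/
theorem rBound_le_coe_iff {𝒯 : Set (H →L[𝕜] E)} {C : ℝ≥0} :
    rBound 𝒯 ≤ C ↔ IsRBoundFor 𝒯 C := by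
  refine ⟨fun h => ?_, fun h => iInf₂_le C h⟩
  have key : ∀ D : ℝ≥0, C < D → IsRBoundFor 𝒯 D := by
    intro D hD
    have h1 : rBound 𝒯 < D := h.trans_lt (by exact_mod_cast hD)
    simp only [rBound, iInf_lt_iff] at h1
    obtain ⟨C', hC', hlt⟩ := h1
    exact hC'.mono subset_rfl (by exact_mod_cast hlt.le)
  intro N T x hT
  set b := 𝔼 ε : Fin N → ℤˣ, ‖∑ j, ε j • x j‖ ^ 2
  -- Every constant strictly above `C` is admissible, and the inequality is closed as `D` decreases
  -- to `C`.
  have hc : Filter.Tendsto (fun D : ℝ≥0 => (D : ℝ) ^ 2 * b) (nhdsWithin C (Set.Ioi C))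
      (nhds ((C : ℝ) ^ 2 * b)) :=
    Filter.Tendsto.mono_left (Continuous.tendsto (by fun_prop) C) nhdsWithin_le_nhds
  exact ge_of_tendsto hc (Filter.eventually_of_mem self_mem_nhdsWithin
    fun D hD => key D hD N T x hT)

theorem coe_lt_rBound_iff {𝒯 : Set (H →L[𝕜] E)} {C : ℝ≥0} :
    (C : ℝ≥0∞) < rBound 𝒯 ↔ ¬ IsRBoundFor 𝒯 C := by
  rw [← rBound_le_coe_iff, not_le]

theorem rBound_mono {𝒮 𝒯 : Set (H →L[𝕜] E)} (h : 𝒮 ⊆ 𝒯) : rBound 𝒮 ≤ rBound 𝒯 :=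
  le_iInf₂ fun C hC => iInf₂_le C (hC.mono h le_rfl)

end RBound

/-! ### Dyadic martingales as binary trees, and stopping. -/

/-- Finite binary trees with leaves labelled in `𝒳`. They describe the `𝒳`-valued dyadic
martingales of finite length. -/
inductive DyadicTree (𝒳 : Type*) : Type _
  | leaf (x : 𝒳) : DyadicTree 𝒳
  | node (l r : DyadicTree 𝒳) : DyadicTree 𝒳

namespace DyadicTree

variable {𝒳 : Type*}

/-- The expectation of `φ` of the final value of the dyadic martingale. -/
noncomputable def mean (φ : 𝒳 → ℝ) : DyadicTree 𝒳 → ℝ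
  | leaf x => φ x
  | node l r => (mean φ l + mean φ r) / 2

theorem mean_nonneg {φ : 𝒳 → ℝ} (hφ : ∀ x, 0 ≤ φ x) (t : DyadicTree 𝒳) : 0 ≤ mean φ t := by
  induction t with
  | leaf x => exact hφ x
  | node l r hl hr => simp only [mean]; linarith

variable [NormedAddCommGroup 𝒳] [NormedSpace ℝ 𝒳]

/-- The starting value of the dyadic martingale. -/
noncomputable def root : DyadicTree 𝒳 → 𝒳
  | leaf x => x
  | node l r => (1 / 2 : ℝ) • (root l + root r)

/-- The expectation of `Φ (S ∪ {values along the path}) (final value)`. -/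
noncomputable def eval (Φ : Set 𝒳 → 𝒳 → ℝ) : DyadicTree 𝒳 → Set 𝒳 → ℝ
  | leaf x, S => Φ (insert x S) x
  | node l r, S =>
      (eval Φ l (insert (root (node l r)) S) + eval Φ r (insert (root (node l r)) S)) / 2

/-- The first step of `eval` already adds the root to the set of visited values, so adding it
beforehand changes nothing. -/
theorem eval_insert_root (Φ : Set 𝒳 → 𝒳 → ℝ) (t : DyadicTree 𝒳) (S : Set 𝒳) :
    eval Φ t (insert (root t) S) = eval Φ t S := by
  cases t <;> simp [eval, root]

theorem eval_mono {Φ : Set 𝒳 → 𝒳 → ℝ} (hΦ : ∀ S T x, S ⊆ T → Φ S x ≤ Φ T x)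
    (t : DyadicTree 𝒳) {S T : Set 𝒳} (h : S ⊆ T) : eval Φ t S ≤ eval Φ t T := by
  induction t generalizing S T with
  | leaf x => exact hΦ _ _ _ (Set.insert_subset_insert h)
  | node l r hl hr =>
    have h' := Set.insert_subset_insert (a := root (node l r)) h
    simp only [eval]
    linarith [hl h', hr h']

theorem eval_le_one {Φ : Set 𝒳 → 𝒳 → ℝ} (hΦ : ∀ S x, Φ S x ≤ 1) (t : DyadicTree 𝒳) (S : Set 𝒳) :
    eval Φ t S ≤ 1 := by
  induction t generalizing S with
  | leaf x => exact hΦ _ _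
  | node l r hl hr =>
    simp only [eval]
    linarith [hl (insert (root (node l r)) S), hr (insert (root (node l r)) S)]

theorem eval_sub (Φ : Set 𝒳 → 𝒳 → ℝ) (φ : 𝒳 → ℝ) (K : ℝ) (t : DyadicTree 𝒳) (S : Set 𝒳) :
    eval (fun S x => Φ S x - K * φ x) t S = eval Φ t S - K * mean φ t := by
  induction t generalizing S with
  | leaf x => rfl
  | node l r hl hr => simp only [eval, mean, hl, hr]; ring

theorem eval_const (φ : 𝒳 → ℝ) (t : DyadicTree 𝒳) (S : Set 𝒳) :
    eval (fun _ x => φ x) t S = mean φ t := by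
  induction t generalizing S with
  | leaf x => rfl
  | node l r hl hr => simp only [eval, mean, hl, hr]

theorem norm_root_le (t : DyadicTree 𝒳) : ‖root t‖ ≤ mean norm t := by
  induction t with
  | leaf x => exact le_rfl
  | node l r hl hr =>
    simp only [root, mean, norm_smul]
    have := norm_add_le (root l) (root r)
    norm_num
    linarith

open Classical in
/-- The dyadic martingale stopped as soon as the conditional expectation of the norm of the final
value exceeds `c`. -/
noncomputable def truncate (c : ℝ) : DyadicTree 𝒳 → DyadicTree 𝒳
  | leaf x => leaf x
  | node l r =>
    if c < mean norm (node l r) then leaf (root (node l r)) else node (truncate c l) (truncate c r)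

theorem root_truncate (c : ℝ) (t : DyadicTree 𝒳) : root (truncate c t) = root t := by
  induction t with
  | leaf x => rfl
  | node l r hl hr =>
    rw [truncate]
    split_ifs
    · rfl
    · simp only [root, hl, hr]

/-- Doob's maximal inequality for the conditional means of the final norm: a path is stopped with
probability at most `mean norm t / c`, and unstopped paths are unchanged. On a stopped branch the
first term alone is at least `1`. -/
theorem eval_le_eval_truncate {Φ : Set 𝒳 → 𝒳 → ℝ} (h0 : ∀ S x, 0 ≤ Φ S x) (h1 : ∀ S x, Φ S x ≤ 1)
    {c : ℝ} (hc : 0 < c) (t : DyadicTree 𝒳) (S : Set 𝒳) :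
    eval Φ t S ≤ mean norm t / c + eval Φ (truncate c t) S := by
  induction t generalizing S with
  | leaf x =>
    have : 0 ≤ mean norm (leaf x) / c := div_nonneg (norm_nonneg x) hc.le
    simp only [truncate]
    linarith
  | node l r hl hr =>
    rw [truncate]
    split_ifs with h
    · have h2 : 1 ≤ mean norm (node l r) / c := (one_le_div hc).2 h.le
      have h3 : 0 ≤ eval Φ (leaf (root (node l r))) S := h0 _ _
      linarith [eval_le_one h1 (node l r) S]
    · have e : root (node (truncate c l) (truncate c r)) = root (node l r) := by
        simp only [root, root_truncate]
      simp only [eval, mean, e]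
      have := hl (insert (root (node l r)) S)
      have := hr (insert (root (node l r)) S)
      have e2 : (mean norm l + mean norm r) / 2 / c = (mean norm l / c + mean norm r / c) / 2 := by
        ring
      linarith

/-- At each leaf of the stopped tree the conditional mean `b` of the original final norm is at most
`2 * c` and dominates the norm of the leaf. Thus `r - 1` of the `r` powers are absorbed by `2 * c`,
and the remaining `b` averages to `mean norm t`. -/
theorem mean_rpow_truncate_le {r c : ℝ} (hr : 1 < r) (t : DyadicTree 𝒳)
    (ht : mean norm t ≤ 2 * c) :
    mean (fun x => ‖x‖ ^ r) (truncate c t) ≤ (2 * c) ^ (r - 1) * mean norm t := by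
  have key : ∀ a b : ℝ, 0 ≤ a → a ≤ b → b ≤ 2 * c → a ^ r ≤ (2 * c) ^ (r - 1) * b := by
    intro a b ha hab hb
    calc a ^ r ≤ b ^ r := Real.rpow_le_rpow ha hab (by linarith)
      _ = b ^ (r - 1) * b := by
        rcases (ha.trans hab).eq_or_lt with h | h
        · rw [← h, Real.zero_rpow (by linarith), mul_zero]
        · rw [Real.rpow_sub_one h.ne', div_mul_cancel₀ _ h.ne']
      _ ≤ _ := by
        have hb0 := ha.trans hab
        gcongr
  induction t with
  | leaf x => exact key _ _ (norm_nonneg x) le_rfl ht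
  | node l r' hl hr' =>
    rw [truncate]
    split_ifs with h
    · exact key _ _ (norm_nonneg _) (norm_root_le _) ht
    · have h0l := mean_nonneg (fun x : 𝒳 => norm_nonneg x) l
      have h0r := mean_nonneg (fun x : 𝒳 => norm_nonneg x) r'
      simp only [mean] at h ⊢
      -- An unstopped node has mean at most `c` and the sibling's mean is nonnegative, so the mean
      -- at most doubles from parent to child.
      have := hl (by linarith)
      have := hr' (by linarith)
      linarith

end DyadicTree

/-! ### From midpoint concavity to concavity. -/

/-- A midpoint concave function that is bounded below on segments is concave. -/
theorem concaveOn_univ_of_midpoint {F : Type*} [AddCommGroup F] [Module ℝ F] {V : F → ℝ}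
    (hmid : ∀ x y, (V x + V y) / 2 ≤ V ((1 / 2 : ℝ) • (x + y)))
    (hbdd : ∀ x y, ∃ m : ℝ, ∀ t ∈ Set.Icc (0 : ℝ) 1, m ≤ V ((1 - t) • x + t • y)) :
    ConcaveOn ℝ Set.univ V := by
  have key : ∀ x y, ∀ t ∈ Set.Icc (0 : ℝ) 1,
      (1 - t) * V x + t * V y ≤ V ((1 - t) • x + t • y) := by
    intro x y
    obtain ⟨m, hm⟩ := hbdd x y
    set φ : ℝ → ℝ := fun t => V ((1 - t) • x + t • y) - ((1 - t) * V x + t * V y) with hφ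
    have hφ0 : φ 0 = 0 := by simp [hφ]
    have hφ1 : φ 1 = 0 := by simp [hφ]
    have hφmid : ∀ s t, (φ s + φ t) / 2 ≤ φ ((s + t) / 2) := by
      intro s t
      have h := hmid ((1 - s) • x + s • y) ((1 - t) • x + t • y)
      have e : (1 / 2 : ℝ) • (((1 - s) • x + s • y) + ((1 - t) • x + t • y)) =
          (1 - (s + t) / 2) • x + ((s + t) / 2) • y := by module
      rw [e] at h
      simp only [hφ]
      linarith
    set A := φ '' Set.Icc (0 : ℝ) 1
    have hAne : A.Nonempty := ⟨φ 0, 0, by simp, rfl⟩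
    have hAbdd : BddBelow A := by
      refine ⟨m - (|V x| + |V y|), ?_⟩
      rintro _ ⟨t, ht, rfl⟩
      have h1 := hm t ht
      have h2 : (1 - t) * V x ≤ |V x| := by
        have := ht.1; have := ht.2
        nlinarith [le_abs_self (V x), abs_nonneg (V x)]
      have h3 : t * V y ≤ |V y| := by
        have := ht.1; have := ht.2
        nlinarith [le_abs_self (V y), abs_nonneg (V y)]
      simp only [hφ]
      linarith
    -- Each `t` is the midpoint of `0` and `2 * t`, or of `1` and `2 * t - 1`, and `φ` vanishes at
    -- both endpoints. So `φ t` is at least half the infimum, which forces the infimum to be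
    -- nonnegative.
    have hhalf : sInf A / 2 ≤ sInf A := by
      refine le_csInf hAne ?_
      rintro _ ⟨t, ht, rfl⟩
      rcases le_total t (1 / 2) with h | h
      · have h1 : sInf A ≤ φ (2 * t) :=
          csInf_le hAbdd ⟨2 * t, ⟨by linarith [ht.1], by linarith⟩, rfl⟩
        have h2 := hφmid 0 (2 * t)
        rw [hφ0, show (0 + 2 * t) / 2 = t by ring] at h2
        linarith
      · have h1 : sInf A ≤ φ (2 * t - 1) :=
          csInf_le hAbdd ⟨2 * t - 1, ⟨by linarith, by linarith [ht.2]⟩, rfl⟩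
        have h2 := hφmid 1 (2 * t - 1)
        rw [hφ1, show (1 + (2 * t - 1)) / 2 = t by ring] at h2
        linarith
    intro t ht
    have h1 : sInf A ≤ φ t := csInf_le hAbdd ⟨t, ht, rfl⟩
    simp only [hφ] at h1
    linarith
  refine ⟨convex_univ, fun x _ y _ a b ha hb hab => ?_⟩
  have h := key x y b ⟨hb, by linarith⟩
  rw [show 1 - b = a by linarith] at h
  simpa using h

/-! ### Functions of the dyadic index on `[0, 1)`. -/

section DyadicIndex

/-- The index of the dyadic interval of length `2^{-j}` that contains the given point. -/
noncomputable def dyadicIndex (j : ℕ) (ξ : Set.Ico (0 : ℝ) 1) : ℕ := ⌊(ξ : ℝ) * 2 ^ j⌋₊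

theorem dyadicIndex_lt (j : ℕ) (ξ : Set.Ico (0 : ℝ) 1) : dyadicIndex j ξ < 2 ^ j := by
  have h2 : (0 : ℝ) < 2 ^ j := by positivity
  have h := mul_lt_mul_of_pos_right ξ.2.2 h2
  rw [dyadicIndex, Nat.floor_lt (mul_nonneg ξ.2.1 h2.le)]
  push_cast
  linarith

theorem dyadicIndex_eq_iff {j k : ℕ} {ξ : Set.Ico (0 : ℝ) 1} :
    dyadicIndex j ξ = k ↔ ξ ∈ dyadicInterval j k := by
  have h2 : (0 : ℝ) < 2 ^ j := by positivity
  rw [dyadicIndex, Nat.floor_eq_iff (mul_nonneg ξ.2.1 h2.le)]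
  simp only [dyadicInterval, Set.mem_ofPred_eq, div_le_iff₀ h2, lt_div_iff₀ h2]

theorem dyadicIndex_eq_div {j N : ℕ} (h : j ≤ N) (ξ : Set.Ico (0 : ℝ) 1) :
    dyadicIndex j ξ = dyadicIndex N ξ / 2 ^ (N - j) := by
  obtain ⟨i, rfl⟩ := Nat.exists_eq_add_of_le h
  have e : (ξ : ℝ) * 2 ^ j = (ξ : ℝ) * 2 ^ (j + i) / ((2 ^ i : ℕ) : ℝ) := by
    push_cast
    rw [pow_add]
    field_simp
  rw [dyadicIndex, e, Nat.floor_div_natCast, Nat.add_sub_cancel_left]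
  rfl

theorem measurableSet_dyadicIndex_eq (j k : ℕ) :
    MeasurableSet[dyadicFiltration j] (dyadicIndex j ⁻¹' {k}) := by
  have e : dyadicIndex j ⁻¹' {k} = dyadicInterval j k := by
    ext ξ; exact dyadicIndex_eq_iff
  by_cases hk : k < 2 ^ j
  · rw [e]
    exact MeasurableSpace.measurableSet_generateFrom ⟨k, hk, rfl⟩
  · convert MeasurableSet.empty
    ext ξ
    simp only [Set.mem_preimage, Set.mem_singleton_iff, Set.mem_empty_iff_false, iff_false]
    have := dyadicIndex_lt j ξ
    omega

theorem measurable_dyadicIndex_filtration (j : ℕ) :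
    Measurable[dyadicFiltration j] (dyadicIndex j) :=
  @measurable_to_countable' _ _ _ _ (_) _ fun k => measurableSet_dyadicIndex_eq j k

theorem measurable_dyadicIndex (j : ℕ) : Measurable (dyadicIndex j) :=
  (measurable_dyadicIndex_filtration j).mono (dyadicFiltration.le j) le_rfl

theorem exists_eq_preimage_dyadicIndex {j : ℕ} {s : Set (Set.Ico (0 : ℝ) 1)}
    (hs : MeasurableSet[dyadicFiltration j] s) : ∃ T : Set ℕ, dyadicIndex j ⁻¹' T = s := by
  have h : dyadicFiltration j ≤ MeasurableSpace.comap (dyadicIndex j) ⊤ := by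
    refine MeasurableSpace.generateFrom_le ?_
    rintro _ ⟨k, -, rfl⟩
    exact ⟨{k}, trivial, by ext ξ; exact dyadicIndex_eq_iff⟩
  obtain ⟨T, -, hT⟩ := h s hs
  exact ⟨T, hT⟩

theorem lebesgueIco_dyadicInterval {j k : ℕ} (hk : k < 2 ^ j) :
    lebesgueIco (dyadicInterval j k) = ENNReal.ofReal ((1 / 2) ^ j) := by
  have h2 : (0 : ℝ) < 2 ^ j := by positivity
  have hk' : (k : ℝ) + 1 ≤ 2 ^ j := by exact_mod_cast hk
  have e : (Subtype.val '' dyadicInterval j k : Set ℝ) =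
      Set.Ico ((k : ℝ) / 2 ^ j) ((k + 1) / 2 ^ j) := by
    ext x
    constructor
    · rintro ⟨ξ, h, rfl⟩
      exact h
    · intro h
      refine ⟨⟨x, le_trans (by positivity) h.1, h.2.trans_le ?_⟩, h, rfl⟩
      rwa [div_le_one h2]
  rw [lebesgueIco, comap_subtype_coe_apply measurableSet_Ico, e, Real.volume_Ico, ← sub_div]
  simp

/-- Under Lebesgue measure the index is uniform on `2 ^ N` values, which reduces integrals to finite
averages. -/
theorem map_dyadicIndex (N : ℕ) :
    lebesgueIco.map (dyadicIndex N) =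
      ∑ k ∈ Finset.range (2 ^ N), ENNReal.ofReal ((1 / 2) ^ N) • Measure.dirac k := by
  refine Measure.ext_of_singleton fun i => ?_
  have e : dyadicIndex N ⁻¹' {i} = dyadicInterval N i := by
    ext ξ; exact dyadicIndex_eq_iff
  rw [Measure.map_apply (measurable_dyadicIndex N) (measurableSet_singleton i)]
  simp only [Measure.coe_finsetSum, Finset.sum_apply, Measure.smul_apply,
    Measure.dirac_apply, smul_eq_mul, Set.indicator_apply, Set.mem_singleton_iff, Pi.one_apply,
    mul_ite, mul_one, mul_zero, Finset.sum_ite_eq', Finset.mem_range]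
  split_ifs with h
  · rw [e, lebesgueIco_dyadicInterval h]
  · convert measure_empty (μ := lebesgueIco)
    ext ξ
    simp only [Set.mem_preimage, Set.mem_singleton_iff, Set.mem_empty_iff_false, iff_false]
    have := dyadicIndex_lt N ξ
    omega

variable {F : Type*} [NormedAddCommGroup F]

theorem integrable_comp_dyadicIndex (N : ℕ) (h : ℕ → F) :
    Integrable (fun ξ => h (dyadicIndex N ξ)) lebesgueIco := by
  have : Integrable h (lebesgueIco.map (dyadicIndex N)) := by
    rw [map_dyadicIndex, integrable_finsetSum_measure]
    intro k _
    exact (integrable_dirac (by simp)).smul_measure ENNReal.ofReal_ne_top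
  exact this.comp_measurable (measurable_dyadicIndex N)

theorem sum_range_two_mul (f : ℕ → F) (n : ℕ) :
    ∑ k ∈ Finset.range (2 * n), f k = ∑ k ∈ Finset.range n, (f (2 * k) + f (2 * k + 1)) := by
  induction n with
  | zero => simp
  | succ n ih =>
    rw [show 2 * (n + 1) = 2 * n + 1 + 1 by ring, Finset.sum_range_succ, Finset.sum_range_succ, ih,
      Finset.sum_range_succ, add_assoc]

variable [NormedSpace ℝ F]

theorem integral_comp_dyadicIndex [CompleteSpace F] (N : ℕ) (h : ℕ → F) :
    ∫ ξ, h (dyadicIndex N ξ) ∂lebesgueIco =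
      ((1 / 2 : ℝ) ^ N) • ∑ k ∈ Finset.range (2 ^ N), h k := by
  rw [← integral_map (measurable_dyadicIndex N).aemeasurable
    (StronglyMeasurable.of_discrete (f := h)).aestronglyMeasurable, map_dyadicIndex,
    integral_finsetSum_measure]
  · rw [Finset.smul_sum]
    refine Finset.sum_congr rfl fun k _ => ?_
    rw [integral_smul_measure, integral_dirac, ENNReal.toReal_ofReal (by positivity)]
  · intro k _
    exact (integrable_dirac (by simp)).smul_measure ENNReal.ofReal_ne_top

/-- Averages over dyadic intervals form a martingale. -/
theorem martingale_comp_dyadicIndex [CompleteSpace F] {g : ℕ → ℕ → F}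
    (hg : ∀ j k, k < 2 ^ j → g j k = (1 / 2 : ℝ) • (g (j + 1) (2 * k) + g (j + 1) (2 * k + 1))) :
    Martingale (fun j ξ => g j (dyadicIndex j ξ)) dyadicFiltration lebesgueIco := by
  classical
  refine martingale_of_setIntegral_eq_succ (fun j => ?_)
    (fun j => integrable_comp_dyadicIndex j (g j)) fun j s hs => ?_
  · exact (StronglyMeasurable.of_discrete (f := g j)).comp_measurable
      (measurable_dyadicIndex_filtration j)
  · have hs' := dyadicFiltration.le j s hs
    obtain ⟨T, rfl⟩ := exists_eq_preimage_dyadicIndex hs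
    rw [← integral_indicator hs', ← integral_indicator hs']
    have e1 : (fun ξ => (dyadicIndex j ⁻¹' T).indicator (fun ξ => g j (dyadicIndex j ξ)) ξ) =
        fun ξ => (fun k => if k ∈ T then g j k else 0) (dyadicIndex j ξ) := by
      ext ξ; simp [Set.indicator_apply]
    have e2 : (fun ξ => (dyadicIndex j ⁻¹' T).indicator
        (fun ξ => g (j + 1) (dyadicIndex (j + 1) ξ)) ξ) =
        fun ξ => (fun k => if k / 2 ∈ T then g (j + 1) k else 0) (dyadicIndex (j + 1) ξ) := by
      ext ξ
      have := dyadicIndex_eq_div (Nat.le_succ j) ξ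
      simp only [Nat.succ_eq_add_one, Nat.add_sub_cancel_left, pow_one] at this
      simp [Set.indicator_apply, this]
    rw [e1, e2, integral_comp_dyadicIndex j (fun k => if k ∈ T then g j k else 0),
      integral_comp_dyadicIndex (j + 1) (fun k => if k / 2 ∈ T then g (j + 1) k else 0), pow_succ' 2 j,
      sum_range_two_mul, pow_succ, mul_smul, Finset.smul_sum (r := (1 / 2 : ℝ))]
    congr 1
    refine Finset.sum_congr rfl fun k hk => ?_
    have h1 : 2 * k / 2 = k := by omega
    have h2 : (2 * k + 1) / 2 = k := by omega
    simp only [h1, h2]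
    split_ifs
    · exact hg j k (Finset.mem_range.1 hk)
    · simp

end DyadicIndex

/-! ### Realising trees as martingales on `[0, 1)`. -/

namespace DyadicTree

variable {𝒳 : Type*}

/-- The length of the dyadic martingale. -/
def depth : DyadicTree 𝒳 → ℕ
  | leaf _ => 0
  | node l r => max (depth l) (depth r) + 1

variable [NormedAddCommGroup 𝒳] [NormedSpace ℝ 𝒳]

/-- The value of the dyadic martingale at time `j` on the `k`-th dyadic interval. -/
noncomputable def value : DyadicTree 𝒳 → ℕ → ℕ → 𝒳
  | leaf x, _, _ => x
  | node l r, 0, _ => root (node l r)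
  | node l r, j + 1, k => if k < 2 ^ j then value l j k else value r j (k - 2 ^ j)

/-- The values of the dyadic martingale up to time `N` on the `k`-th dyadic interval of length
`2^{-N}`. -/
def pathSet (t : DyadicTree 𝒳) (N k : ℕ) : Set 𝒳 :=
  {x | ∃ j ≤ N, value t j (k / 2 ^ (N - j)) = x}

theorem value_zero (t : DyadicTree 𝒳) (k : ℕ) : value t 0 k = root t := by
  cases t <;> rfl

theorem value_eq_average (t : DyadicTree 𝒳) (j k : ℕ) (hk : k < 2 ^ j) :
    value t j k = (1 / 2 : ℝ) • (value t (j + 1) (2 * k) + value t (j + 1) (2 * k + 1)) := by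
  induction t generalizing j k with
  | leaf x =>
    simp only [value]
    module
  | node l r hl hr =>
    cases j with
    | zero =>
      obtain rfl : k = 0 := by simpa using hk
      simp [value, value_zero, root]
    | succ j =>
      have hp : 2 ^ (j + 1) = 2 * 2 ^ j := pow_succ' 2 j
      simp only [value]
      by_cases h : k < 2 ^ j
      · rw [if_pos h, if_pos (by omega), if_pos (by omega), hl j k h]
      · rw [if_neg h, if_neg (by omega), if_neg (by omega), hr j _ (by omega)]
        rw [show 2 * (k - 2 ^ j) = 2 * k - 2 ^ (j + 1) by omega,
          show 2 * k - 2 ^ (j + 1) + 1 = 2 * k + 1 - 2 ^ (j + 1) by omega]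

/-- After its depth the tree martingale is constant in time, so a finite tree becomes an infinite
martingale with a final value. -/
theorem value_succ_of_depth_le (t : DyadicTree 𝒳) {N : ℕ} (h : depth t ≤ N) (k : ℕ) :
    value t (N + 1) k = value t N (k / 2) := by
  induction t generalizing N k with
  | leaf x => rfl
  | node l r hl hr =>
    simp only [depth] at h
    obtain ⟨M, rfl⟩ : ∃ M, N = M + 1 := ⟨N - 1, by omega⟩
    have hp : 2 ^ (M + 1) = 2 * 2 ^ M := pow_succ' 2 M
    simp only [value]
    by_cases hk : k < 2 ^ (M + 1)
    · rw [if_pos hk, if_pos (by omega), hl (by omega)]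
    · rw [if_neg hk, if_neg (by omega), hr (by omega)]
      congr 1
      omega

theorem pathSet_leaf (x : 𝒳) (N k : ℕ) : pathSet (leaf x) N k = {x} := by
  ext y
  simp only [pathSet, value, Set.mem_ofPred_eq, Set.mem_singleton_iff]
  exact ⟨fun ⟨_, _, h⟩ => h.symm, fun h => ⟨0, Nat.zero_le _, h.symm⟩⟩

theorem pathSet_node_left (l r : DyadicTree 𝒳) {M k : ℕ} (hk : k < 2 ^ M) :
    pathSet (node l r) (M + 1) k = insert (root (node l r)) (pathSet l M k) := by
  have hv : ∀ j ≤ M, value (node l r) (j + 1) (k / 2 ^ (M + 1 - (j + 1))) =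
      value l j (k / 2 ^ (M - j)) := by
    intro j hj
    rw [Nat.add_sub_add_right, value, if_pos]
    rw [Nat.div_lt_iff_lt_mul (by positivity), ← pow_add]
    rwa [Nat.add_sub_cancel' hj]
  ext y
  simp only [pathSet, Set.mem_ofPred_eq, Set.mem_insert_iff]
  constructor
  · rintro ⟨_ | j, hj, rfl⟩
    · exact Or.inl (value_zero _ _)
    · exact Or.inr ⟨j, by omega, (hv j (by omega)).symm⟩
  · rintro (rfl | ⟨j, hj, rfl⟩)
    · exact ⟨0, Nat.zero_le _, value_zero _ _⟩
    · exact ⟨j + 1, by omega, hv j hj⟩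

theorem pathSet_node_right (l r : DyadicTree 𝒳) (M k : ℕ) :
    pathSet (node l r) (M + 1) (2 ^ M + k) = insert (root (node l r)) (pathSet r M k) := by
  have hv : ∀ j ≤ M, value (node l r) (j + 1) ((2 ^ M + k) / 2 ^ (M + 1 - (j + 1))) =
      value r j (k / 2 ^ (M - j)) := by
    intro j hj
    have e : (2 ^ M + k) / 2 ^ (M - j) = 2 ^ j + k / 2 ^ (M - j) := by
      rw [show 2 ^ M + k = k + 2 ^ (M - j) * 2 ^ j by
        rw [← pow_add, Nat.sub_add_cancel hj, add_comm], Nat.add_mul_div_left _ _ (by positivity),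
        add_comm]
    rw [Nat.add_sub_add_right, e, value, if_neg (by simp), Nat.add_sub_cancel_left]
  ext y
  simp only [pathSet, Set.mem_ofPred_eq, Set.mem_insert_iff]
  constructor
  · rintro ⟨_ | j, hj, rfl⟩
    · exact Or.inl (value_zero _ _)
    · exact Or.inr ⟨j, by omega, (hv j (by omega)).symm⟩
  · rintro (rfl | ⟨j, hj, rfl⟩)
    · exact ⟨0, Nat.zero_le _, value_zero _ _⟩
    · exact ⟨j + 1, by omega, hv j hj⟩

theorem eval_eq_sum (Φ : Set 𝒳 → 𝒳 → ℝ) (t : DyadicTree 𝒳) {N : ℕ} (hN : depth t ≤ N)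
    (S : Set 𝒳) :
    eval Φ t S =
      (1 / 2) ^ N * ∑ k ∈ Finset.range (2 ^ N), Φ (S ∪ pathSet t N k) (value t N k) := by
  induction t generalizing N S with
  | leaf x =>
    simp only [eval, pathSet_leaf, Set.union_singleton, value, Finset.sum_const,
      Finset.card_range, nsmul_eq_mul, Nat.cast_pow, Nat.cast_ofNat]
    rw [← mul_assoc, ← mul_pow]
    norm_num
  | node l r hl hr =>
    simp only [depth] at hN
    obtain ⟨M, rfl⟩ : ∃ M, N = M + 1 := ⟨N - 1, by omega⟩
    simp only [eval]
    rw [hl (N := M) (by omega), hr (N := M) (by omega), pow_succ' 2 M, two_mul,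
      Finset.sum_range_add]
    have e1 : ∑ k ∈ Finset.range (2 ^ M),
        Φ (S ∪ pathSet (node l r) (M + 1) k) (value (node l r) (M + 1) k) =
        ∑ k ∈ Finset.range (2 ^ M),
          Φ (insert (root (node l r)) S ∪ pathSet l M k) (value l M k) := by
      refine Finset.sum_congr rfl fun k hk => ?_
      have hk := Finset.mem_range.1 hk
      rw [pathSet_node_left l r hk, value, if_pos hk, Set.union_insert, Set.insert_union]
    have e2 : ∑ k ∈ Finset.range (2 ^ M),
        Φ (S ∪ pathSet (node l r) (M + 1) (2 ^ M + k)) (value (node l r) (M + 1) (2 ^ M + k)) =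
        ∑ k ∈ Finset.range (2 ^ M),
          Φ (insert (root (node l r)) S ∪ pathSet r M k) (value r M k) := by
      refine Finset.sum_congr rfl fun k hk => ?_
      rw [pathSet_node_right l r, value, if_neg (by omega), Nat.add_sub_cancel_left,
        Set.union_insert, Set.insert_union]
    rw [e1, e2]
    ring

theorem eval_eq_integral (Φ : Set 𝒳 → 𝒳 → ℝ) (t : DyadicTree 𝒳) {N : ℕ} (hN : depth t ≤ N)
    (S : Set 𝒳) :
    eval Φ t S = ∫ ξ, Φ (S ∪ pathSet t N (dyadicIndex N ξ)) (value t N (dyadicIndex N ξ))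
      ∂lebesgueIco := by
  rw [eval_eq_sum Φ t hN, integral_comp_dyadicIndex N
    (fun k => Φ (S ∪ pathSet t N k) (value t N k)), smul_eq_mul]

theorem value_dyadicIndex_of_depth_le (t : DyadicTree 𝒳) {N j : ℕ} (hN : depth t ≤ N) (hj : N ≤ j)
    (ξ : Set.Ico (0 : ℝ) 1) :
    value t j (dyadicIndex j ξ) = value t N (dyadicIndex N ξ) := by
  induction j, hj using Nat.le_induction with
  | base => rfl
  | succ j hj ih =>
    have := dyadicIndex_eq_div (Nat.le_succ j) ξ
    simp only [Nat.succ_eq_add_one, Nat.add_sub_cancel_left, pow_one] at this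
    rw [value_succ_of_depth_le t (hN.trans hj), ← this, ih]

theorem range_value_dyadicIndex (t : DyadicTree 𝒳) {N : ℕ} (hN : depth t ≤ N)
    (ξ : Set.Ico (0 : ℝ) 1) :
    Set.range (fun j => value t j (dyadicIndex j ξ)) = pathSet t N (dyadicIndex N ξ) := by
  ext x
  simp only [Set.mem_range, pathSet, Set.mem_ofPred_eq]
  constructor
  · rintro ⟨j, rfl⟩
    rcases le_total j N with h | h
    · exact ⟨j, h, by rw [← dyadicIndex_eq_div h]⟩
    · refine ⟨N, le_rfl, ?_⟩
      rw [value_dyadicIndex_of_depth_le t hN h, ← dyadicIndex_eq_div le_rfl]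
  · rintro ⟨j, h, rfl⟩
    exact ⟨j, by rw [← dyadicIndex_eq_div h]⟩

/-- Identifies the tree martingale with the one to which the `RMF_p` hypothesis applies. -/
theorem condExp_value_dyadicIndex [CompleteSpace 𝒳] (t : DyadicTree 𝒳) {N : ℕ} (hN : depth t ≤ N)
    (j : ℕ) :
    lebesgueIco[fun ξ => value t N (dyadicIndex N ξ) | dyadicFiltration j] =ᵐ[lebesgueIco]
      fun ξ => value t j (dyadicIndex j ξ) := by
  have hm := martingale_comp_dyadicIndex (g := value t) (value_eq_average t)
  have h := hm.condExp_ae_eq (le_max_left j N)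
  have e : (fun ξ => value t (max j N) (dyadicIndex (max j N) ξ)) =
      fun ξ => value t N (dyadicIndex N ξ) := by
    ext ξ
    exact value_dyadicIndex_of_depth_le t hN (le_max_right j N) ξ
  simpa only [e] using h

end DyadicTree

/-! ### Strong and weak type estimates for finite dyadic martingales. -/

section

variable {𝕜 H E 𝒳 : Type*} [RCLike 𝕜]
  [NormedAddCommGroup H] [NormedSpace 𝕜 H] [NormedAddCommGroup E] [NormedSpace 𝕜 E]
  [NormedAddCommGroup 𝒳] [NormedSpace 𝕜 𝒳]

open Classical in
/-- The indicator of the families in `𝒳` whose R-bound exceeds `l`. -/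
noncomputable def rIndicator (emb : 𝒳 →ₗ[𝕜] (H →L[𝕜] E)) (l : ℝ≥0) (S : Set 𝒳) : ℝ :=
  if (l : ℝ≥0∞) < rBound (emb '' S) then 1 else 0

variable {emb : 𝒳 →ₗ[𝕜] (H →L[𝕜] E)} {l : ℝ≥0}

theorem rIndicator_nonneg (S : Set 𝒳) : 0 ≤ rIndicator emb l S := by
  rw [rIndicator]; split_ifs <;> norm_num

theorem rIndicator_le_one (S : Set 𝒳) : rIndicator emb l S ≤ 1 := by
  rw [rIndicator]; split_ifs <;> norm_num

theorem rIndicator_mono {S T : Set 𝒳} (h : S ⊆ T) : rIndicator emb l S ≤ rIndicator emb l T := by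
  have h' := rBound_mono (Set.image_mono (f := emb) h)
  rw [rIndicator, rIndicator]
  split_ifs with h1 h2
  · exact le_rfl
  · exact absurd (h1.trans_le h') h2
  · norm_num
  · exact le_rfl

variable [NormedSpace ℝ 𝒳] [CompleteSpace 𝒳]

/-- Chebyshev's inequality for the Rademacher maximal function of a finite dyadic martingale. -/
theorem rpow_mul_eval_rIndicator_le {p : ℝ≥0∞} (hp0 : p ≠ 0) (hp : p ≠ ∞) {C : ℝ≥0}
    (hC : ∀ f : Set.Ico (0 : ℝ) 1 → 𝒳, MemLp f p lebesgueIco →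
      eLpNorm (rademacherMax emb fun j => lebesgueIco[f | dyadicFiltration j]) p lebesgueIco ≤
        C * eLpNorm f p lebesgueIco)
    (t : DyadicTree 𝒳) :
    (l : ℝ) ^ p.toReal * t.eval (fun S _ => rIndicator emb l S) ∅ ≤
      (C : ℝ) ^ p.toReal * t.mean (fun x => ‖x‖ ^ p.toReal) := by
  set N := t.depth
  set r := p.toReal
  have hr : 0 < r := ENNReal.toReal_pos hp0 hp
  set f : Set.Ico (0 : ℝ) 1 → 𝒳 := fun ξ => t.value N (dyadicIndex N ξ) with hf
  set G : Set.Ico (0 : ℝ) 1 → ℝ≥0∞ := fun ξ => rBound (emb '' t.pathSet N (dyadicIndex N ξ))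
    with hG
  have hfsm : StronglyMeasurable f :=
    (StronglyMeasurable.of_discrete (f := t.value N)).comp_measurable (measurable_dyadicIndex N)
  have hGm : Measurable G :=
    (measurable_from_nat (f := fun k => rBound (emb '' t.pathSet N k))).comp
      (measurable_dyadicIndex N)
  have hint : Integrable (fun ξ => ‖f ξ‖ ^ r) lebesgueIco :=
    integrable_comp_dyadicIndex N (fun k => ‖t.value N k‖ ^ r)
  have hmem : MemLp f p lebesgueIco :=
    (integrable_norm_rpow_iff hfsm.aestronglyMeasurable hp0 hp).1 hint
  have hae : (rademacherMax emb fun j => lebesgueIco[f | dyadicFiltration j]) =ᵐ[lebesgueIco] G := by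
    have h := ae_all_iff.2 fun j => t.condExp_value_dyadicIndex le_rfl j
    filter_upwards [h] with ξ hξ
    rw [rademacherMax, hG]
    dsimp only
    rw [← t.range_value_dyadicIndex le_rfl ξ, ← Set.range_comp]
    congr 2
    ext1 j
    simp only [Function.comp_apply, ← hξ j]
    rfl
  have h1 := hC f hmem
  rw [eLpNorm_congr_ae hae, eLpNorm_eq_lintegral_rpow_enorm_toReal hp0 hp,
    eLpNorm_eq_lintegral_rpow_enorm_toReal hp0 hp] at h1
  have h2 := ENNReal.rpow_le_rpow h1 hr.le
  rw [ENNReal.mul_rpow_of_nonneg _ _ hr.le, ← ENNReal.rpow_mul, ← ENNReal.rpow_mul,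
    one_div_mul_cancel hr.ne', ENNReal.rpow_one, ENNReal.rpow_one] at h2
  have h3 : (l : ℝ≥0∞) ^ r * lebesgueIco {ξ | (l : ℝ≥0∞) < G ξ} ≤ ∫⁻ ξ, ‖G ξ‖ₑ ^ r ∂lebesgueIco := by
    refine le_trans ?_ (mul_meas_ge_le_lintegral (hGm.enorm.pow_const r) ((l : ℝ≥0∞) ^ r))
    gcongr with ξ
    intro hξ
    exact ENNReal.rpow_le_rpow (le_of_lt hξ) hr.le
  have h4 := h3.trans h2
  have e1 : ∫⁻ ξ, ‖f ξ‖ₑ ^ r ∂lebesgueIco =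
      ENNReal.ofReal (t.mean (fun x => ‖x‖ ^ r)) := by
    rw [← DyadicTree.eval_const _ t ∅, DyadicTree.eval_eq_integral _ t le_rfl,
      ofReal_integral_eq_lintegral_ofReal hint (Filter.Eventually.of_forall fun ξ => by positivity)]
    refine lintegral_congr fun ξ => ?_
    rw [← ofReal_norm, ENNReal.ofReal_rpow_of_nonneg (norm_nonneg _) hr.le]
  have e2 : t.eval (fun S _ => rIndicator emb l S) ∅ =
      lebesgueIco.real {ξ | (l : ℝ≥0∞) < G ξ} := by
    rw [DyadicTree.eval_eq_integral _ t le_rfl, ← integral_indicator_one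
      (measurableSet_lt measurable_const hGm)]
    refine integral_congr_ae (Filter.Eventually.of_forall fun ξ => ?_)
    simp only [Set.empty_union, rIndicator, Set.indicator_apply, Set.mem_ofPred_eq, hG,
      Pi.one_apply]
    congr
  rw [e1] at h4
  have h5 := ENNReal.toReal_mono (ENNReal.mul_ne_top
    (ENNReal.rpow_ne_top_of_nonneg hr.le ENNReal.coe_ne_top) ENNReal.ofReal_ne_top) h4
  rw [ENNReal.toReal_mul, ENNReal.toReal_mul, ← ENNReal.toReal_rpow, ← ENNReal.toReal_rpow,
    ENNReal.toReal_ofReal (DyadicTree.mean_nonneg (fun x => by positivity) t)] at h5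
  rw [e2]
  exact h5

/-- The weak type inequality for finite dyadic martingales. -/
theorem eval_rIndicator_le {p : ℝ≥0∞} (hp1 : 1 < p) (hp : p ≠ ∞) {C : ℝ≥0}
    (hC : ∀ f : Set.Ico (0 : ℝ) 1 → 𝒳, MemLp f p lebesgueIco →
      eLpNorm (rademacherMax emb fun j => lebesgueIco[f | dyadicFiltration j]) p lebesgueIco ≤
        C * eLpNorm f p lebesgueIco)
    (hl : 0 < l) (t : DyadicTree 𝒳) :
    t.eval (fun S _ => rIndicator emb l S) ∅ ≤
      (1 + (C : ℝ) ^ p.toReal * 2 ^ (p.toReal - 1)) / l * t.mean norm := by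
  set r := p.toReal
  have hr : 1 < r := by
    have := (ENNReal.toReal_lt_toReal ENNReal.one_ne_top hp).2 hp1
    simpa using this
  have hl' : (0 : ℝ) < l := hl
  have hm := DyadicTree.mean_nonneg (fun x : 𝒳 => norm_nonneg x) t
  have hK : 0 ≤ (C : ℝ) ^ r * 2 ^ (r - 1) := by positivity
  -- Stopping at level `l` needs the root mean to be at most `2 * l`. Otherwise the right-hand side
  -- exceeds `1` and the bound is trivial.
  rcases le_or_gt (t.mean norm) (2 * l) with h | h
  · have h1 := DyadicTree.eval_le_eval_truncate (Φ := fun S _ => rIndicator emb l S)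
      (fun S _ => rIndicator_nonneg S) (fun S _ => rIndicator_le_one S) hl' t ∅
    have h2 := rpow_mul_eval_rIndicator_le (l := l) (zero_lt_one.trans hp1).ne' hp hC (t.truncate l)
    have h3 := DyadicTree.mean_rpow_truncate_le hr t h
    have h4 : (DyadicTree.truncate l t).eval (fun S _ => rIndicator emb l S) ∅ ≤
        (C : ℝ) ^ r * 2 ^ (r - 1) / l * t.mean norm := by
      have h5 : (l : ℝ) ^ r * (DyadicTree.truncate l t).eval (fun S _ => rIndicator emb l S) ∅ ≤
          (C : ℝ) ^ r * ((2 * l) ^ (r - 1) * t.mean norm) :=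
        h2.trans (mul_le_mul_of_nonneg_left h3 (by positivity))
      rw [Real.mul_rpow (by norm_num) hl'.le, Real.rpow_sub_one hl'.ne'] at h5
      have hlr : 0 < (l : ℝ) ^ r := by positivity
      refine le_of_mul_le_mul_left (h5.trans_eq ?_) hlr
      ring
    calc _ ≤ _ := h1
      _ ≤ _ := add_le_add_right h4 _
      _ = _ := by ring
  · refine (DyadicTree.eval_le_one (fun S _ => rIndicator_le_one S) t ∅).trans ?_
    rw [div_mul_eq_mul_div, one_le_div hl']
    nlinarith

end

/-! ### The Bellman function. -/

section Bellman

variable {F : Type*} [NormedAddCommGroup F] [NormedSpace ℝ F]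

/-- The Bellman function of `Φ`: the largest value of `DyadicTree.eval Φ` for dyadic martingales
starting at `x`. -/
noncomputable def bellman (Φ : Set F → F → ℝ) (S : Set F) (x : F) : ℝ :=
  sSup {a | ∃ t : DyadicTree F, t.root = x ∧ t.eval Φ S = a}

variable {Φ : Set F → F → ℝ}

theorem eval_le_bellman (h1 : ∀ S x, Φ S x ≤ 1) (S : Set F) (t : DyadicTree F) :
    t.eval Φ S ≤ bellman Φ S t.root :=
  le_csSup ⟨1, by rintro _ ⟨t, -, rfl⟩; exact t.eval_le_one h1 S⟩ ⟨t, rfl, rfl⟩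

theorem bellman_le {S : Set F} {x : F} {a : ℝ}
    (h : ∀ t : DyadicTree F, t.root = x → t.eval Φ S ≤ a) : bellman Φ S x ≤ a := by
  refine csSup_le ⟨_, DyadicTree.leaf x, rfl, rfl⟩ ?_
  rintro _ ⟨t, ht, rfl⟩
  exact h t ht

theorem le_bellman (h1 : ∀ S x, Φ S x ≤ 1) (hmono : ∀ S T x, S ⊆ T → Φ S x ≤ Φ T x)
    (S : Set F) (x : F) : Φ S x ≤ bellman Φ S x :=
  (hmono _ _ _ (Set.subset_insert x S)).trans (eval_le_bellman h1 S (DyadicTree.leaf x))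

theorem bellman_insert_le (h1 : ∀ S x, Φ S x ≤ 1) (S : Set F) (x : F) :
    bellman Φ (insert x S) x ≤ bellman Φ S x := by
  refine bellman_le ?_
  rintro t rfl
  rw [DyadicTree.eval_insert_root]
  exact eval_le_bellman h1 S t

/-- Two trees hung below a common node form a competitor at the midpoint; the extra visited value
cannot decrease `Φ`. The one-leaf tree supplies the lower bound needed to upgrade midpoint
concavity. -/
theorem concaveOn_bellman (h1 : ∀ S x, Φ S x ≤ 1) (hmono : ∀ S T x, S ⊆ T → Φ S x ≤ Φ T x)
    {K : ℝ} (hK : 0 ≤ K) (hbelow : ∀ S x, -(K * ‖x‖) ≤ Φ S x) (S : Set F) :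
    ConcaveOn ℝ Set.univ (bellman Φ S) := by
  refine concaveOn_univ_of_midpoint (fun x y => ?_) fun x y => ⟨-(K * (‖x‖ + ‖y‖)), fun t ht => ?_⟩
  · have key : ∀ t u : DyadicTree F, t.root = x → u.root = y →
        t.eval Φ S + u.eval Φ S ≤ 2 * bellman Φ S ((1 / 2 : ℝ) • (x + y)) := by
      rintro t u rfl rfl
      have h := eval_le_bellman h1 S (DyadicTree.node t u)
      have ht := t.eval_mono hmono (Set.subset_insert (DyadicTree.node t u).root S)
      have hu := u.eval_mono hmono (Set.subset_insert (DyadicTree.node t u).root S)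
      simp only [DyadicTree.eval] at h
      simp only [DyadicTree.root] at h ht hu
      linarith
    have hx : bellman Φ S x ≤ 2 * bellman Φ S ((1 / 2 : ℝ) • (x + y)) - bellman Φ S y := by
      refine bellman_le fun t ht => ?_
      have hy : bellman Φ S y ≤ 2 * bellman Φ S ((1 / 2 : ℝ) • (x + y)) - t.eval Φ S :=
        bellman_le fun u hu => by linarith [key t u ht hu]
      linarith
    linarith
  · refine le_trans ?_ ((hbelow S _).trans (le_bellman h1 hmono S _))
    have : ‖(1 - t) • x + t • y‖ ≤ ‖x‖ + ‖y‖ := by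
      refine (norm_add_le _ _).trans (add_le_add ?_ ?_)
      · rw [norm_smul, Real.norm_of_nonneg (by linarith [ht.2])]
        exact mul_le_of_le_one_left (norm_nonneg _) (by linarith [ht.1])
      · rw [norm_smul, Real.norm_of_nonneg ht.1]
        exact mul_le_of_le_one_left (norm_nonneg _) ht.2
    have := mul_le_mul_of_nonneg_left this hK
    linarith

end Bellman

/-! ### Averages over successively split atoms. -/

section Atoms

variable {Ω F : Type*} {m : MeasurableSpace Ω}

/-- A function that takes finitely many values, each on a measurable set. -/
structure IsSimple (m : MeasurableSpace Ω) (s : Ω → F) : Prop where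
  finite_range : (Set.range s).Finite
  measurableSet_preimage : ∀ c, MeasurableSet[m] (s ⁻¹' {c})

theorem IsSimple.mono {m' : MeasurableSpace Ω} {s : Ω → F} (h : IsSimple m' s) (hm : m' ≤ m) :
    IsSimple m s :=
  ⟨h.1, fun c => hm _ (h.2 c)⟩

theorem IsSimple.biUnion_inter_preimage {s : Ω → F} (hs : IsSimple m s) (A : Set Ω) :
    ⋃ c ∈ hs.1.toFinset, A ∩ s ⁻¹' {c} = A := by
  ext ω
  simp

theorem pairwiseDisjoint_inter_preimage_singleton (s : Ω → F) (A : Set Ω) (I : Set F) :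
    I.PairwiseDisjoint fun c => A ∩ s ⁻¹' {c} := by
  intro c _ d _ hcd
  refine Set.disjoint_left.2 ?_
  rintro ω ⟨-, h1⟩ ⟨-, h2⟩
  exact hcd (h1.symm.trans h2)

theorem IsSimple.sum_setIntegral {G : Type*} [NormedAddCommGroup G] [NormedSpace ℝ G]
    {s : Ω → F} (hs : IsSimple m s) {P : Measure Ω} {A : Set Ω} (hA : MeasurableSet A) {f : Ω → G}
    (hf : Integrable f P) :
    ∑ c ∈ hs.1.toFinset, ∫ ω in A ∩ s ⁻¹' {c}, f ω ∂P = ∫ ω in A, f ω ∂P := by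
  rw [← integral_biUnion_finset _ (fun c _ => hA.inter (hs.2 c))
    (pairwiseDisjoint_inter_preimage_singleton s A _) (fun c _ => hf.integrableOn),
    hs.biUnion_inter_preimage A]

variable [NormedAddCommGroup F] [NormedSpace ℝ F]

theorem measureReal_smul_setAverage (P : Measure Ω) [IsFiniteMeasure P] (f : Ω → F) (A : Set Ω) :
    P.real A • ⨍ ω in A, f ω ∂P = ∫ ω in A, f ω ∂P := by
  rcases eq_or_ne (P.real A) 0 with h | h
  · rw [h, zero_smul, setIntegral_measure_zero]
    exact (measureReal_eq_zero_iff).1 h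
  · rw [setAverage_eq, smul_inv_smul₀ h]

/-- The averages of `f` over the atom containing `ω`, as the set `A` is split successively by the
functions in the list. -/
noncomputable def atomAverages (P : Measure Ω) (f : Ω → F) :
    List (Ω → F) → Set Ω → Ω → Set F
  | [], _, _ => ∅
  | s :: L, A, ω => insert (⨍ x in A ∩ s ⁻¹' {s ω}, f x ∂P)
      (atomAverages P f L (A ∩ s ⁻¹' {s ω}) ω)

/-- The average of `f` over the atom containing `ω`, after `A` has been split by all the functions
in the list. -/
noncomputable def lastAverage (P : Measure Ω) (f : Ω → F) :
    List (Ω → F) → Set Ω → Ω → F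
  | [], A, _ => ⨍ x in A, f x ∂P
  | s :: L, A, ω => lastAverage P f L (A ∩ s ⁻¹' {s ω}) ω

theorem lastAverage_mem_atomAverages (P : Measure Ω) (f : Ω → F) {L L' : List (Ω → F)}
    (hL : L ≠ []) (h : L <+: L') (A : Set Ω) (ω : Ω) :
    lastAverage P f L A ω ∈ atomAverages P f L' A ω := by
  induction L generalizing L' A with
  | nil => exact absurd rfl hL
  | cons s L ih =>
    obtain ⟨L'', rfl, h'⟩ : ∃ L'', L' = s :: L'' ∧ L <+: L'' := by
      obtain ⟨R, rfl⟩ := h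
      exact ⟨L ++ R, rfl, L.prefix_append R⟩
    by_cases hL0 : L = []
    · subst hL0
      exact Set.mem_insert _ _
    · exact Set.mem_insert_of_mem _ (ih hL0 h' _)

/-- Martingales of averages over successively finer atoms inherit the inequality encoded in a
concave function `U` of Bellman type. -/
theorem measureReal_atomAverages_le (P : Measure Ω) [IsFiniteMeasure P] {f : Ω → F}
    (hf : Integrable f P) {U : Set F → F → ℝ} {K : ℝ} {B : Set F → Prop} (hK : 0 ≤ K)
    (hU : ∀ S, ConcaveOn ℝ Set.univ (U S)) (hins : ∀ S x, U (insert x S) x ≤ U S x)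
    (h0 : ∀ S x, 0 ≤ U S x + K * ‖x‖) (h1 : ∀ S x, B S → 1 ≤ U S x + K * ‖x‖)
    (L : List (Ω → F)) (hL : ∀ s ∈ L, IsSimple m s) {A : Set Ω} (hA : MeasurableSet A)
    (S : Set F) :
    P.real (A ∩ {ω | B (S ∪ atomAverages P f L A ω)}) ≤
      P.real A * U S (⨍ ω in A, f ω ∂P) + K * ∫ ω in A, ‖f ω‖ ∂P := by
  induction L generalizing A S with
  | nil =>
    have hav : P.real A * ‖⨍ ω in A, f ω ∂P‖ ≤ ∫ ω in A, ‖f ω‖ ∂P := by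
      rw [← Real.norm_of_nonneg (measureReal_nonneg (μ := P) (s := A)), ← norm_smul,
        measureReal_smul_setAverage]
      exact norm_integral_le_integral_norm _
    have hav' := mul_le_mul_of_nonneg_left hav hK
    have hPA : 0 ≤ P.real A := measureReal_nonneg
    simp only [atomAverages, Set.union_empty]
    by_cases hB : B S
    · have h2 := mul_le_mul_of_nonneg_left (h1 S (⨍ ω in A, f ω ∂P) hB) hPA
      have h3 : P.real (A ∩ {ω : Ω | B S}) ≤ P.real A := measureReal_mono Set.inter_subset_left
      linarith
    · have h2 := mul_le_mul_of_nonneg_left (h0 S (⨍ ω in A, f ω ∂P)) hPA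
      simp only [hB, Set.ofPred_false, Set.inter_empty, measureReal_empty]
      linarith
  | cons s L ih =>
    have hs := hL s List.mem_cons_self
    have hAc : ∀ c, MeasurableSet (A ∩ s ⁻¹' {c}) := fun c => hA.inter (hs.2 c)
    have hKf : 0 ≤ K * ∫ ω in A, ‖f ω‖ ∂P :=
      mul_nonneg hK (integral_nonneg fun _ => norm_nonneg _)
    -- Jensen's inequality below uses the weights divided by `P.real A`, so null atoms are treated
    -- separately.
    rcases (measureReal_nonneg (μ := P) (s := A)).eq_or_lt with hPA | hPA
    · have h3 := measureReal_mono (μ := P)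
        (Set.inter_subset_left (s := A) (t := {ω | B (S ∪ atomAverages P f (s :: L) A ω)}))
      rw [← hPA] at h3 ⊢
      linarith
    set z : F → F := fun c => ⨍ ω in A ∩ s ⁻¹' {c}, f ω ∂P with hz
    have hsub : A ∩ {ω | B (S ∪ atomAverages P f (s :: L) A ω)} ⊆
        ⋃ c ∈ hs.1.toFinset, (A ∩ s ⁻¹' {c}) ∩
          {ω | B (insert (z c) S ∪ atomAverages P f L (A ∩ s ⁻¹' {c}) ω)} := by
      rintro ω ⟨hωA, hω⟩
      simp only [Set.mem_iUnion]
      refine ⟨s ω, by simp, ⟨hωA, rfl⟩, ?_⟩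
      have hω' : B (S ∪ atomAverages P f (s :: L) A ω) := hω
      rw [atomAverages, Set.union_insert, ← Set.insert_union] at hω'
      exact hω'
    have hsum1 : ∑ c ∈ hs.1.toFinset, P.real (A ∩ s ⁻¹' {c}) = P.real A := by
      have := hs.sum_setIntegral hA (integrable_const (μ := P) (1 : ℝ))
      simpa using this
    have hsumf : ∑ c ∈ hs.1.toFinset, P.real (A ∩ s ⁻¹' {c}) • z c = ∫ ω in A, f ω ∂P := by
      rw [← hs.sum_setIntegral hA hf]
      exact Finset.sum_congr rfl fun c _ => measureReal_smul_setAverage P f _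
    -- The average over `A` is the convex combination of the averages over its pieces; here
    -- arbitrary masses are allowed because `U S` is fully concave.
    have hjensen : ∑ c ∈ hs.1.toFinset, P.real (A ∩ s ⁻¹' {c}) * U S (z c) ≤
        P.real A * U S (⨍ ω in A, f ω ∂P) := by
      have h := (hU S).le_map_sum (t := hs.1.toFinset)
        (w := fun c => (P.real A)⁻¹ * P.real (A ∩ s ⁻¹' {c})) (p := z)
        (fun c _ => by positivity)
        (by rw [← Finset.mul_sum, hsum1, inv_mul_cancel₀ hPA.ne']) (fun _ _ => Set.mem_univ _)
      simp only [mul_smul, ← Finset.smul_sum, hsumf, ← setAverage_eq] at h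
      simpa only [smul_eq_mul, inv_mul_le_iff₀ hPA] using h
    calc P.real (A ∩ {ω | B (S ∪ atomAverages P f (s :: L) A ω)})
        ≤ P.real (⋃ c ∈ hs.1.toFinset, (A ∩ s ⁻¹' {c}) ∩
          {ω | B (insert (z c) S ∪ atomAverages P f L (A ∩ s ⁻¹' {c}) ω)}) :=
          measureReal_mono hsub (measure_ne_top _ _)
      _ ≤ ∑ c ∈ hs.1.toFinset, P.real ((A ∩ s ⁻¹' {c}) ∩
          {ω | B (insert (z c) S ∪ atomAverages P f L (A ∩ s ⁻¹' {c}) ω)}) :=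
          measureReal_biUnion_finset_le _ _
      _ ≤ ∑ c ∈ hs.1.toFinset, (P.real (A ∩ s ⁻¹' {c}) * U S (z c) +
          K * ∫ ω in A ∩ s ⁻¹' {c}, ‖f ω‖ ∂P) := by
          refine Finset.sum_le_sum fun c _ => ?_
          refine (ih (fun s hs => hL s (List.mem_cons_of_mem _ hs)) (hAc c)
            (insert (z c) S)).trans ?_
          gcongr
          -- The induction hypothesis has `z c` among the visited values; this removes it, so that
          -- one concave function `U S` serves all pieces.
          exact hins S (z c)
      _ = ∑ c ∈ hs.1.toFinset, P.real (A ∩ s ⁻¹' {c}) * U S (z c) +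
          K * ∫ ω in A, ‖f ω‖ ∂P := by
          rw [Finset.sum_add_distrib, ← Finset.mul_sum, hs.sum_setIntegral hA hf.norm]
      _ ≤ _ := by gcongr

/-- Averaging over atoms on which `s` is constant approximates `g` in `L¹` as well as `s` does, up
to a factor `2`. -/
theorem lintegral_lastAverage_sub_le [CompleteSpace F] (P : Measure Ω) [IsFiniteMeasure P] {m' : MeasurableSpace Ω}
    (hm : m' ≤ m) {f g : Ω → F} (hg : Integrable g P)
    (hfg : ∀ B, MeasurableSet[m'] B → ∫ ω in B, f ω ∂P = ∫ ω in B, g ω ∂P)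
    (L : List (Ω → F)) {s : Ω → F} (hL : ∀ u ∈ L ++ [s], IsSimple m' u)
    {A : Set Ω} (hA : MeasurableSet[m'] A) :
    ∫⁻ ω in A, ‖lastAverage P f (L ++ [s]) A ω - g ω‖ₑ ∂P ≤ 2 * ∫⁻ ω in A, ‖g ω - s ω‖ₑ ∂P := by
  have split : ∀ {u : Ω → F} (hu : IsSimple m' u) {A : Set Ω} (hA : MeasurableSet[m'] A)
      (h : Ω → ℝ≥0∞), ∫⁻ ω in A, h ω ∂P = ∑ c ∈ hu.1.toFinset, ∫⁻ ω in A ∩ u ⁻¹' {c}, h ω ∂P := by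
    intro u hu A hA h
    rw [← lintegral_biUnion_finset (pairwiseDisjoint_inter_preimage_singleton u A _)
      (fun c _ => hm _ (hA.inter (hu.2 c))), hu.biUnion_inter_preimage A]
  induction L generalizing A with
  | nil =>
    have hs := hL s (by simp)
    rw [split hs hA, split hs hA (fun ω => ‖g ω - s ω‖ₑ), Finset.mul_sum]
    refine Finset.sum_le_sum fun c _ => ?_
    set B := A ∩ s ⁻¹' {c}
    have hB : MeasurableSet[m'] B := hA.inter (hs.2 c)
    have hBm : MeasurableSet[m] B := hm _ hB
    set a := ⨍ ω in B, f ω ∂P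
    have e1 : ∫⁻ ω in B, ‖lastAverage P f ([] ++ [s]) A ω - g ω‖ₑ ∂P =
        ∫⁻ ω in B, ‖a - g ω‖ₑ ∂P := by
      refine setLIntegral_congr_fun hBm fun ω hω => ?_
      have : s ω = c := hω.2
      simp only [List.nil_append, lastAverage, this]
      rfl
    have e2 : ∫⁻ ω in B, ‖g ω - s ω‖ₑ ∂P = ∫⁻ ω in B, ‖g ω - c‖ₑ ∂P := by
      refine setLIntegral_congr_fun hBm fun ω hω => ?_
      have : s ω = c := hω.2
      simp only [this]
    -- On `B`, the functions `f` and `g` have the same integral, so `a - c` is the average of `g -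
    -- c`. This second copy of the error accounts for the factor `2`.
    have h1 : ∫⁻ _ in B, ‖a - c‖ₑ ∂P ≤ ∫⁻ ω in B, ‖g ω - c‖ₑ ∂P := by
      have e3 : P.real B • (a - c) = ∫ ω in B, (g ω - c) ∂P := by
        rw [smul_sub, measureReal_smul_setAverage, hfg B hB, integral_sub hg.integrableOn
          (integrable_const c), setIntegral_const]
      rw [setLIntegral_const, mul_comm, ← ofReal_measureReal (μ := P) (s := B),
        ← Real.enorm_of_nonneg measureReal_nonneg, ← enorm_smul, e3]
      exact enorm_integral_le_lintegral_enorm _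
    rw [e1, e2, two_mul]
    calc ∫⁻ ω in B, ‖a - g ω‖ₑ ∂P ≤ ∫⁻ ω in B, (‖a - c‖ₑ + ‖g ω - c‖ₑ) ∂P := by
          refine lintegral_mono fun ω => ?_
          have := enorm_sub_le (a := a - c) (b := g ω - c)
          rwa [sub_sub_sub_cancel_right] at this
      _ = ∫⁻ _ in B, ‖a - c‖ₑ ∂P + ∫⁻ ω in B, ‖g ω - c‖ₑ ∂P :=
          lintegral_add_left measurable_const _
      _ ≤ _ := by gcongr
  | cons u L ih =>
    have hu := hL u (by simp)
    rw [split hu hA, split hu hA (fun ω => ‖g ω - s ω‖ₑ), Finset.mul_sum]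
    refine Finset.sum_le_sum fun c _ => ?_
    have hB : MeasurableSet[m'] (A ∩ u ⁻¹' {c}) := hA.inter (hu.2 c)
    refine le_trans (le_of_eq ?_) (ih (fun v hv => hL v (by simp_all)) hB)
    refine setLIntegral_congr_fun (hm _ hB) fun ω hω => ?_
    have : u ω = c := hω.2
    simp only [List.cons_append, lastAverage, this]

end Atoms

/-! ### Approximating a martingale by atom averages. -/

section Approximation

variable {Ω F : Type*} [NormedAddCommGroup F] {m : MeasurableSpace Ω}

theorem IsSimple.stronglyMeasurable {s : Ω → F} (hs : IsSimple m s) : StronglyMeasurable s :=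
  (SimpleFunc.mk s hs.measurableSet_preimage hs.finite_range).stronglyMeasurable

theorem exists_isSimple_lintegral_sub_le {P : Measure Ω} {m' : MeasurableSpace Ω} (hm : m' ≤ m)
    {g : Ω → F} (hgm : StronglyMeasurable[m'] g) (hg : Integrable g P) {δ : ℝ≥0∞} (hδ : δ ≠ 0) :
    ∃ s : Ω → F, IsSimple m' s ∧ ∫⁻ ω, ‖g ω - s ω‖ₑ ∂P ≤ δ := by
  have hg' : MemLp g 1 (P.trim hm) := memLp_one_iff_integrable.2 (hg.trim hm hgm)
  obtain ⟨s, hs, -⟩ := hg'.exists_simpleFunc_eLpNorm_sub_lt ENNReal.one_ne_top hδ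
  refine ⟨s, ⟨s.finite_range, fun c => s.measurableSet_fiber c⟩, ?_⟩
  rw [eLpNorm_trim hm (hgm.sub s.stronglyMeasurable), eLpNorm_one_eq_lintegral_enorm] at hs
  exact hs.le

theorem isSimple_lastAverage [NormedSpace ℝ F] (P : Measure Ω) (f : Ω → F) (L : List (Ω → F))
    (hL : ∀ s ∈ L, IsSimple m s) (A : Set Ω) : IsSimple m (lastAverage P f L A) := by
  induction L generalizing A with
  | nil =>
    refine ⟨(Set.finite_singleton (⨍ x in A, f x ∂P)).subset ?_, fun c => ?_⟩
    · rintro _ ⟨ω, rfl⟩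
      rfl
    · exact MeasurableSet.const (⨍ x in A, f x ∂P = c)
  | cons s L ih =>
    have hs := hL s List.mem_cons_self
    have ih' := fun c => ih (fun u hu => hL u (List.mem_cons_of_mem _ hu)) (A ∩ s ⁻¹' {c})
    constructor
    · refine (hs.finite_range.biUnion fun c _ => (ih' c).finite_range).subset ?_
      rintro _ ⟨ω, rfl⟩
      exact Set.mem_biUnion (Set.mem_range_self ω) ⟨ω, rfl⟩
    · intro x
      have e : lastAverage P f (s :: L) A ⁻¹' {x} =
          ⋃ c ∈ Set.range s, s ⁻¹' {c} ∩ lastAverage P f L (A ∩ s ⁻¹' {c}) ⁻¹' {x} := by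
        ext ω
        simp only [lastAverage, Set.mem_preimage, Set.mem_singleton_iff, Set.mem_iUnion,
          Set.mem_inter_iff]
        refine ⟨fun h => ⟨s ω, ⟨ω, rfl⟩, rfl, h⟩, ?_⟩
        rintro ⟨c, -, rfl, h⟩
        exact h
      rw [e]
      exact hs.finite_range.measurableSet_biUnion fun c _ =>
        (hs.measurableSet_preimage c).inter ((ih' c).measurableSet_preimage x)

/-- An `L¹` martingale is the almost everywhere limit of averages over finitely many atoms, along
lists of simple functions. -/
theorem exists_lists_tendsto_lastAverage [NormedSpace ℝ F] [CompleteSpace F] {P : Measure Ω}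
    [IsProbabilityMeasure P] {ℱ : Filtration ℕ m} {X : ℕ → Ω → F} (hX : Martingale X ℱ P) :
    ∃ L : ℕ → ℕ → List (Ω → F), (∀ n j, ∀ s ∈ L n j, IsSimple m s) ∧ (∀ n j, L n j ≠ []) ∧
      (∀ n j, j ≤ n → L n j <+: L n n) ∧
      ∀ᵐ ω ∂P, ∀ j, Filter.Tendsto (fun n => lastAverage P (X n) (L n j) Set.univ ω)
        Filter.atTop (nhds (X j ω)) := by
  have hδ : ∀ n : ℕ, ((2 : ℝ≥0∞)⁻¹ ^ n) ≠ 0 := fun n => pow_ne_zero _ (by simp)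
  choose s hs hsX using fun n j => exists_isSimple_lintegral_sub_le (ℱ.le j)
    (hX.stronglyAdapted j) (hX.integrable j) (hδ n)
  have hmem : ∀ n j, ∀ u ∈ (List.range j).map (s n) ++ [s n j], IsSimple (ℱ j) u := by
    intro n j u hu
    simp only [List.mem_append, List.mem_map, List.mem_range, List.mem_singleton] at hu
    rcases hu with ⟨i, hi, rfl⟩ | rfl
    · exact (hs n i).mono (ℱ.mono hi.le)
    · exact hs n j
  have hmem' : ∀ n j, ∀ u ∈ (List.range j).map (s n) ++ [s n j], IsSimple m u :=
    fun n j u hu => (hmem n j u hu).mono (ℱ.le j)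
  refine ⟨fun n j => (List.range j).map (s n) ++ [s n j], hmem', fun n j => by simp, ?_, ?_⟩
  · intro n j hj
    have e : ∀ i, (List.range i).map (s n) ++ [s n i] = (List.range (i + 1)).map (s n) := by
      intro i
      simp [List.range_succ]
    simp only [e]
    refine List.IsPrefix.map _ ?_
    obtain ⟨i, rfl⟩ := Nat.exists_eq_add_of_le hj
    rw [show j + i + 1 = (j + 1) + i by omega, List.range_add (n := j + 1)]
    exact List.prefix_append _ _
  · refine ae_all_iff.2 fun j => ?_
    set Z : ℕ → Ω → F := fun n => lastAverage P (X n) ((List.range j).map (s n) ++ [s n j]) Set.univ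
    have hZ : ∀ n, StronglyMeasurable (Z n) := fun n =>
      (isSimple_lastAverage P (X n) _ (hmem' n j) _).stronglyMeasurable
    have hXj : StronglyMeasurable (X j) := (hX.stronglyAdapted j).mono (ℱ.le j)
    have hmeas : ∀ n, AEMeasurable (fun ω => ‖Z (n + j) ω - X j ω‖ₑ) P := fun n =>
      ((hZ (n + j)).sub hXj).enorm.aemeasurable
    -- The shift by `j` makes `X (n + j)` a later variable, with the same integrals as `X j` over
    -- sets of `ℱ j`. The errors are geometric, hence summable, which gives almost everywhere
    -- convergence without passing to a subsequence.
    have hle : ∀ n, ∫⁻ ω, ‖Z (n + j) ω - X j ω‖ₑ ∂P ≤ 2 * (2 : ℝ≥0∞)⁻¹ ^ n := by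
      intro n
      have h := lintegral_lastAverage_sub_le P (ℱ.le j) (f := X (n + j)) (hX.integrable j)
        (fun B hB => (hX.setIntegral_eq (Nat.le_add_left j n) hB).symm)
        ((List.range j).map (s (n + j))) (hmem (n + j) j) (A := Set.univ) MeasurableSet.univ
      rw [Measure.restrict_univ] at h
      refine h.trans ?_
      gcongr
      refine (hsX (n + j) j).trans ?_
      exact pow_le_pow_right_of_le_one' (by simp) (Nat.le_add_right n j)
    have hsum : ∫⁻ ω, ∑' n, ‖Z (n + j) ω - X j ω‖ₑ ∂P ≠ ∞ := by
      rw [lintegral_tsum hmeas]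
      refine ne_top_of_le_ne_top ?_ (ENNReal.tsum_le_tsum hle)
      rw [ENNReal.tsum_mul_left, ENNReal.tsum_geometric]
      simp [ENNReal.mul_eq_top]
    have hae := ae_lt_top' (AEMeasurable.tsum hmeas) hsum
    filter_upwards [hae] with ω hω
    have h0 := ENNReal.tendsto_atTop_zero_of_tsum_ne_top hω.ne
    rw [← Filter.tendsto_add_atTop_iff_nat j, tendsto_iff_edist_tendsto_0]
    simpa only [edist_eq_enorm_sub] using h0

end Approximation

/-! ### Stability of large R-bounds under limits. -/

section RBoundLimit

variable {𝕜 H E : Type*} [RCLike 𝕜]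
  [NormedAddCommGroup H] [NormedSpace 𝕜 H] [NormedAddCommGroup E] [NormedSpace 𝕜 E]

/-- Lower semicontinuity of the R-bound with respect to pointwise convergence of families. -/
theorem eventually_lt_rBound {l : ℝ≥0} {T : ℕ → H →L[𝕜] E} {S : ℕ → ℕ → H →L[𝕜] E}
    {𝒮 : ℕ → Set (H →L[𝕜] E)} (hT : (l : ℝ≥0∞) < rBound (Set.range T))
    (hS : ∀ j, Filter.Tendsto (fun n => S n j) Filter.atTop (nhds (T j)))
    (hmem : ∀ n j, j ≤ n → S n j ∈ 𝒮 n) :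
    ∀ᶠ n in Filter.atTop, (l : ℝ≥0∞) < rBound (𝒮 n) := by
  rw [coe_lt_rBound_iff, IsRBoundFor] at hT
  push Not at hT
  -- A violation of the R-bound involves finitely many operators and a strict inequality, so it
  -- persists for nearby operators once `n` passes all the indices involved.
  obtain ⟨N, T', x, hT', hlt⟩ := hT
  choose i hi using hT'
  have hcont : Continuous fun R : Fin N → H →L[𝕜] E =>
      𝔼 ε : Fin N → ℤˣ, ‖∑ j, ε j • R j (x j)‖ ^ 2 := by
    simp only [Finset.expect, Units.smul_def]
    fun_prop
  have hlim : Filter.Tendsto (fun n j => S n (i j)) Filter.atTop (nhds T') := by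
    refine tendsto_pi_nhds.2 fun j => ?_
    rw [← hi j]
    exact hS (i j)
  filter_upwards [((hcont.tendsto T').comp hlim).eventually_const_lt hlt,
    Filter.eventually_all.2 fun j => Filter.eventually_ge_atTop (i j)] with n hn hn'
  rw [coe_lt_rBound_iff]
  intro h
  exact absurd (h N _ x fun j => hmem n (i j) (hn' j)) (not_le.2 hn)

end RBoundLimit

/-! ### The weak type inequality for general martingales. -/

theorem mainTheorem9 {𝕜 H E 𝒳 : Type*} [RCLike 𝕜]
    [NormedAddCommGroup H] [NormedSpace 𝕜 H] [CompleteSpace H]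
    [NormedAddCommGroup E] [NormedSpace 𝕜 E] [CompleteSpace E]
    [NormedAddCommGroup 𝒳] [NormedSpace 𝕜 𝒳] [NormedSpace ℝ 𝒳] [IsScalarTower ℝ 𝕜 𝒳]
    [CompleteSpace 𝒳]
    (emb : 𝒳 →ₗ[𝕜] (H →L[𝕜] E)) (emb_injective : Function.Injective emb)
    (norm_emb_le : ∀ T : 𝒳, ‖emb T‖ ≤ ‖T‖)
    (hRMF : ∃ p : ℝ≥0∞, 1 < p ∧ p < ∞ ∧ HasRMF emb p) :
    HasWeakRMF.{v} emb := by
  obtain ⟨p, hp1, hp, C, hC⟩ := hRMF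
  -- The summand `1` pays for stopping, the other for the strong type bound on the stopped
  -- martingale.
  set K₀ : ℝ≥0 := 1 + C ^ p.toReal * 2 ^ (p.toReal - 1) with hK₀
  refine ⟨K₀, fun Ω m P _ ℱ X hX _ l hl => ?_⟩
  have hemb : Continuous emb := AddMonoidHomClass.continuous_of_bound emb 1
    (by simpa using norm_emb_le)
  set K : ℝ≥0 := K₀ / l with hK
  set Φ : Set 𝒳 → 𝒳 → ℝ := fun S x => rIndicator emb l S - K * ‖x‖ with hΦ
  have hKx : ∀ x : 𝒳, 0 ≤ K * ‖x‖ := fun x => by positivity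
  have hΦ1 : ∀ S x, Φ S x ≤ 1 := fun S x => by
    have := rIndicator_le_one (emb := emb) (l := l) S
    simp only [hΦ]
    linarith [hKx x]
  have hΦmono : ∀ S T x, S ⊆ T → Φ S x ≤ Φ T x := fun S T x h =>
    sub_le_sub_right (rIndicator_mono h) _
  have hΦbelow : ∀ S x, -(K * ‖x‖) ≤ Φ S x := fun S x => by
    have := rIndicator_nonneg (emb := emb) (l := l) S
    simp only [hΦ]
    linarith
  have hU0 : ∀ x, bellman Φ ∅ x ≤ 0 := fun x => by
    refine bellman_le fun t _ => ?_
    have h := eval_rIndicator_le hp1 hp.ne hC hl t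
    rw [hΦ, DyadicTree.eval_sub, sub_nonpos]
    convert h using 2
    simp [hK, hK₀]
  obtain ⟨L, hLs, hLne, hLpre, hLlim⟩ := exists_lists_tendsto_lastAverage hX
  set B : Set 𝒳 → Prop := fun S => (l : ℝ≥0∞) < rBound (emb '' S) with hB
  set A : ℕ → Set Ω := fun n => {ω | B (atomAverages P (X n) (L n n) Set.univ ω)} with hA
  have hPA : ∀ n, P (A n) ≤ (K : ℝ≥0∞) * ⨆ j, eLpNorm (X j) 1 P := by
    intro n
    have h := measureReal_atomAverages_le P (hX.integrable n) (U := bellman Φ) (B := B)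
      K.coe_nonneg (concaveOn_bellman hΦ1 hΦmono K.coe_nonneg hΦbelow)
      (bellman_insert_le hΦ1)
      (fun S x => by linarith [hΦbelow S x, le_bellman hΦ1 hΦmono S x])
      (fun S x hS => by
        have h1 : Φ S x = 1 - K * ‖x‖ := by
          simp only [hΦ, rIndicator]
          rw [if_pos hS]
        linarith [le_bellman hΦ1 hΦmono S x])
      (L n n) (hLs n n) MeasurableSet.univ ∅
    simp only [Set.univ_inter, Set.empty_union, Measure.restrict_univ, probReal_univ,
      one_mul] at h
    have h2 : P.real (A n) ≤ K * ∫ ω, ‖X n ω‖ ∂P := 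
      h.trans (by linarith [hU0 (⨍ ω, X n ω ∂P)])
    rw [← ofReal_measureReal (μ := P) (s := A n)]
    refine (ENNReal.ofReal_le_ofReal h2).trans ?_
    rw [ENNReal.ofReal_mul K.coe_nonneg, ENNReal.ofReal_coe_nnreal,
      ofReal_integral_norm_eq_lintegral_enorm (hX.integrable n), ← eLpNorm_one_eq_lintegral_enorm]
    gcongr
    exact le_iSup (fun j => eLpNorm (X j) 1 P) n
  -- Almost every point of the event lies in `A n` for all large `n`, so the bound on each `P (A n)`
  -- passes to the increasing union of the tail intersections.
  have hsub : P {ω | (l : ℝ≥0∞) < rademacherMax emb X ω} ≤ P (⋃ M, ⋂ n ≥ M, A n) := by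
    refine measure_mono_ae ?_
    filter_upwards [hLlim] with ω hω hlt
    have hev := eventually_lt_rBound hlt (fun j => (hemb.tendsto _).comp (hω j))
      (𝒮 := fun n => emb '' atomAverages P (X n) (L n n) Set.univ ω)
      (fun n j hj => Set.mem_image_of_mem _
        (lastAverage_mem_atomAverages P (X n) (hLne n j) (hLpre n j hj) _ ω))
    obtain ⟨M, hM⟩ := Filter.eventually_atTop.1 hev
    exact Set.mem_iUnion.2 ⟨M, Set.mem_iInter₂.2 hM⟩
  have hmono : Monotone fun M => ⋂ n ≥ M, A n := fun M M' h =>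
    Set.biInter_subset_biInter_left fun n hn => h.trans hn
  refine hsub.trans ?_
  rw [hmono.measure_iUnion]
  exact iSup_le fun M => (measure_mono (Set.biInter_subset_of_mem (le_refl M))).trans (hPA M)
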